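/- Graphs are finite multigraphs without loops (multiple edges allowed). For a graph $G$ with vertex set $V(G)$ and disjoint $A,B\subseteq V(G)$, let $E(A,B)$ be the multiset of edges with one end in $A$ and the other in $B$. - The edge-connectivity $\lambda(G)$ is the smallest number of edges whose removal leaves a disconnected graph or the graph on a single vertex (so $\lambda(G)=0$ if $|V(G)|=1$). - The Cartesian product $G\square H$ has vertex set $V(G)\times V(H)$; distinct vertices $(u_1,v_1)$ and $(u_2,v_2)$ are joined by as many edges as $v_1,v_2$ in $H$ if $u_1=u_2$, by as many edges as $u_1,u_2$ in $G$ if $v_1=v_2$, and by none otherwise. - A scramble on $G$ is a collection of nonempty connected sets of vertices, called eggs. Its order is the maximum $k$ such that no set of fewer than $k$ vertices meets every egg, and $|E(A,A^c)|\ge k$ for every $A\subseteq V(G)$ such that $A$ contains an egg and $A^c$ contains an egg. The scramble number $\mathrm{sn}(G)$ is the maximum order of a scramble on $G$. - A divisor on $G$ is a function $D:V(G)\to\mathbb Z$; its degree is $\sum_v D(v)$, and it is effective if $D\ge 0$. Chip-firing a vertex $w$ decreases $D(w)$ by the number of edges at $w$ and increases $D(v)$ by $|E(\{v\},\{w\})|$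 for every $v\ne w$; two divisors are equivalent if one is obtained from the other by finitely many chip-firing moves. The rank of $D$ is $-1$ if $D$ is not equivalent to an effective divisor, and otherwise the largest integer $r$ such that $D-E$ is equivalent to an effective divisor for every effective divisor $E$ of degree $r$. The gonality $\mathrm{gon}(G)$ is the minimum degree of a divisor of positive rank. **Theorem.** Let $G$ and $H$ be connected graphs. (i) If $G$ is a tree and $\frac{|V(H)|}{\lambda(H)}\le |V(G)|$, then $\mathrm{sn}(G\square H)=\mathrm{gon}(G\square H)=|V(H)|$. (ii) If $\mathrm{gon}(H)=\lambda(H)$ and $|V(G)|\le\frac{|V(H)|}{\lambda(H)}$, then $\mathrm{sn}(G\square H)=\mathrm{gon}(G\square H)=|V(G)|\cdot\lambda(H)$. (If $H$ has only one vertex, then $\lambda(H)=0$ and the quotient is read as $0$; the theorem includes this case.) -/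

import Mathlib

/-- A multigraph on the vertex set `V`: a finite multiset of edges (unordered pairs of vertices),
multiple edges allowed, loops not allowed. -/
structure Multigraph (V : Type*) where
  edges : Multiset (Sym2 V)
  loopless : ∀ e ∈ edges, ¬ e.IsDiag

namespace Multigraph

section Basic

variable {V : Type*}

/-- The underlying simple graph: `u` and `v` are adjacent when at least one edge joins them. -/
def toSimpleGraph (G : Multigraph V) : SimpleGraph V where
  Adj u v := s(u, v) ∈ G.edges
  symm := ⟨fun u v h => by rwa [Sym2.eq_swap]⟩
  loopless := ⟨fun v h => G.loopless _ h (Sym2.mk_isDiag_iff.2 rfl)⟩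

/-- Connected (in particular, nonempty). -/
def Connected (G : Multigraph V) : Prop := G.toSimpleGraph.Connected

/-- A tree: connected and without cycles; two parallel edges form a cycle. -/
def IsTree (G : Multigraph V) : Prop := G.edges.Nodup ∧ G.toSimpleGraph.IsTree

/-- A set of vertices is connected when it is nonempty and induces a connected subgraph. -/
def ConnectedSubset (G : Multigraph V) (S : Finset V) : Prop :=
  (G.toSimpleGraph.induce (S : Set V)).Connected

variable [DecidableEq V]

/-- The number of edges joining `u` and `v`. -/
def mult (G : Multigraph V) (u v : V) : ℕ := G.edges.count s(u, v)

/-- The valence of a vertex: the number of edges incident to it. -/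
def val (G : Multigraph V) (v : V) : ℕ := (G.edges.filter (fun e => v ∈ e)).card

/-- The multiset `E(A, B)` of edges with one end in `A` and the other end in `B`
(used for disjoint `A` and `B`). -/
def edgesBetween (G : Multigraph V) (A B : Finset V) : Multiset (Sym2 V) :=
  G.edges.filter (fun e => ∃ a ∈ A, ∃ b ∈ B, e = s(a, b))

/-- Removal of a multiset of edges. -/
def deleteEdges (G : Multigraph V) (D : Multiset (Sym2 V)) : Multigraph V where
  edges := G.edges - D
  loopless e he := G.loopless e (Multiset.mem_of_le (Multiset.sub_le_self _ _) he)

/-- An edge cut: a sub-multiset of the edges whose removal leaves a disconnected graph or the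
graph on a single vertex. -/
def IsEdgeCut [Fintype V] (G : Multigraph V) (D : Multiset (Sym2 V)) : Prop :=
  D ≤ G.edges ∧ (¬ (G.deleteEdges D).Connected ∨ Fintype.card V = 1)

/-- The edge-connectivity `λ(G)`: the smallest cardinality of an edge cut. -/
noncomputable def edgeConnectivity [Fintype V] (G : Multigraph V) : ℕ :=
  sInf {n : ℕ | ∃ D, G.IsEdgeCut D ∧ Multiset.card D = n}

end Basic

section Product

variable {V W : Type*} [Fintype V] [Fintype W]

/-- The Cartesian product `G □ H`: a copy of `G` for every vertex of `H` and a copy of `H` for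
every vertex of `G`. -/
def boxProd (G : Multigraph V) (H : Multigraph W) : Multigraph (V × W) where
  edges := (∑ w : W, G.edges.map (Sym2.map (fun u => (u, w)))) +
    ∑ u : V, H.edges.map (Sym2.map (fun w => (u, w)))
  loopless e he := by
    rcases Multiset.mem_add.1 he with h | h
    · obtain ⟨w, -, h⟩ := Multiset.mem_sum.1 h
      obtain ⟨e', he', rfl⟩ := Multiset.mem_map.1 h
      induction e' with
      | _ a b => simpa using G.loopless _ he'
    · obtain ⟨u, -, h⟩ := Multiset.mem_sum.1 h
      obtain ⟨e', he', rfl⟩ := Multiset.mem_map.1 h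
      induction e' with
      | _ a b => simpa using H.loopless _ he'

end Product

section Scrambles

variable {V : Type*}

/-- A scramble: a collection of connected (nonempty) sets of vertices, its eggs. -/
structure Scramble (G : Multigraph V) where
  eggs : Finset (Finset V)
  connected : ∀ E ∈ eggs, G.ConnectedSubset E

variable [Fintype V] [DecidableEq V]

/-- The two conditions in the definition of the order of a scramble: no set of fewer than `k`
vertices meets all eggs, and whenever `A` contains an egg and its complement contains an egg, at
least `k` edges join `A` to its complement. -/
def Scramble.OrderAtLeast {G : Multigraph V} (S : G.Scramble) (k : ℕ) : Prop :=
  (∀ C : Finset V, C.card < k → ¬ ∀ E ∈ S.eggs, (C ∩ E).Nonempty) ∧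
  (∀ A : Finset V, (∃ E ∈ S.eggs, E ⊆ A) → (∃ E ∈ S.eggs, E ⊆ Aᶜ) →
    k ≤ Multiset.card (G.edgesBetween A Aᶜ))

/-- The scramble order: the maximum `k` satisfying both conditions. -/
noncomputable def Scramble.order {G : Multigraph V} (S : G.Scramble) : ℕ :=
  sSup {k : ℕ | S.OrderAtLeast k}

theorem Scramble.OrderAtLeast.le_card {G : Multigraph V} {S : G.Scramble} {k : ℕ}
    (h : S.OrderAtLeast k) : k ≤ Fintype.card V := by
  by_contra hk
  refine h.1 Finset.univ (by simpa using hk) fun E hE => ?_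
  obtain ⟨v⟩ := (S.connected E hE).nonempty
  exact ⟨v.1, by simp⟩

/-- The maximum in the definition of the scramble order exists. -/
theorem Scramble.isGreatest_order {G : Multigraph V} (S : G.Scramble) :
    IsGreatest {k : ℕ | S.OrderAtLeast k} S.order :=
  have hb : BddAbove {k : ℕ | S.OrderAtLeast k} := ⟨_, fun _ hk => hk.le_card⟩
  ⟨Nat.sSup_mem ⟨0, fun _ h => absurd h (Nat.not_lt_zero _), fun _ _ _ => Nat.zero_le _⟩ hb,
    fun _ hk => le_csSup hb hk⟩

/-- The scramble number: the maximum order of a scramble. -/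
noncomputable def scrambleNumber (G : Multigraph V) : ℕ :=
  sSup (Set.range fun S : G.Scramble => S.order)

/-- The maximum in the definition of the scramble number exists. -/
theorem isGreatest_scrambleNumber (G : Multigraph V) :
    IsGreatest (Set.range fun S : G.Scramble => S.order) G.scrambleNumber :=
  have hb : BddAbove (Set.range fun S : G.Scramble => S.order) :=
    ⟨Fintype.card V, by rintro _ ⟨S, rfl⟩; exact S.isGreatest_order.1.le_card⟩
  ⟨Nat.sSup_mem ⟨_, ⟨⟨∅, by simp⟩, rfl⟩⟩ hb, fun _ hk => le_csSup hb hk⟩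

end Scrambles

section Divisors

variable {V : Type*} [DecidableEq V]

/-- Chip-firing the vertex `w` of the divisor `D`: `w` loses `val w` chips, and every other vertex
gains one chip for each edge joining it to `w`. Divisors are functions `V → ℤ`. -/
def fire (G : Multigraph V) (w : V) (D : V → ℤ) : V → ℤ := fun v =>
  if v = w then D w - G.val w else D v + Multiset.card (G.edgesBetween {v} {w})

/-- Equivalence of divisors: `D₂` is obtained from `D₁` by a finite sequence of chip-firing
moves. -/
def DivEquiv (G : Multigraph V) (D₁ D₂ : V → ℤ) : Prop :=
  Relation.ReflTransGen (fun D D' => ∃ w, D' = G.fire w D) D₁ D₂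

/-- `D` is equivalent to an effective divisor. -/
def EquivEffective (G : Multigraph V) (D : V → ℤ) : Prop :=
  ∃ D' : V → ℤ, G.DivEquiv D D' ∧ ∀ v, 0 ≤ D' v

variable [Fintype V]

/-- The degree of a divisor. -/
def degree (D : V → ℤ) : ℤ := ∑ v, D v

open Classical in
/-- The rank of a divisor: `-1` if it is not equivalent to an effective divisor, and otherwise the
largest `r` such that `D - E` is equivalent to an effective divisor for all effective `E` of
degree `r`. -/
noncomputable def rank (G : Multigraph V) (D : V → ℤ) : ℤ :=
  if G.EquivEffective D then
    ((sSup {r : ℕ | ∀ E : V → ℤ, (∀ v, 0 ≤ E v) → degree E = r →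
      G.EquivEffective (D - E)} : ℕ) : ℤ)
  else -1

/-- The gonality: the minimum degree of a divisor of positive rank (such a divisor is equivalent to
an effective one, so its degree is a natural number). -/
noncomputable def gonality (G : Multigraph V) : ℕ :=
  sInf {d : ℕ | ∃ D : V → ℤ, 0 < G.rank D ∧ degree D = d}

end Divisors

end Multigraph

namespace Multigraph

/-! Both parts squeeze sn ≤ gon between matching bounds. From above, a divisor of positive rank on
one factor pulls back along the projection: the Laplacian of a pulled-back function is the
pulled-back Laplacian, so firing scripts lift, and the degree is multiplied by the size of the other
factor (`gonality_boxProd_le_gonality_mul_card`, `gonality_boxProd_le_card_mul_gonality`). A tree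
has gonality at most 1. From below, take the copies of `G` as eggs (`orderAtLeast_copyScramble`).
They are |V(H)| disjoint sets, and a vertex set containing one copy and avoiding another cuts every
copy of `H`, which costs |V(G)|·λ(H) edges. The hypothesis on the quotient decides which of the two
numbers is the smaller. The general inequality sn ≤ gon rests on `Scramble.OrderAtLeast.le_degree`,
an extremal argument on the level sets of a firing script. -/

theorem degree_sub {V : Type*} [Fintype V] (D E : V → ℤ) : degree (D - E) = degree D - degree E := by
  simp [degree]

theorem ConnectedSubset.exists_adj {V : Type*} {G : Multigraph V}
    {E U : Finset V} (hE : G.ConnectedSubset E) {a b : V} (ha : a ∈ E) (haU : a ∈ U) (hb : b ∈ E) (hbU : b ∉ U) :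
    ∃ x ∈ E, x ∈ U ∧ ∃ y ∈ E, y ∉ U ∧ G.toSimpleGraph.Adj x y := by
  obtain ⟨p⟩ := hE.preconnected ⟨a, ha⟩ ⟨b, hb⟩
  obtain ⟨d, -, h1, h2⟩ := p.exists_boundary_dart {x | x.1 ∈ U} haU hbU
  exact ⟨_, d.fst.2, h1, _, d.snd.2, h2, d.adj⟩

/-! ### Firing scripts, linear equivalence and positive rank. -/

section Laplacian

variable {V : Type*} [DecidableEq V]

theorem mult_comm (G : Multigraph V) (u v : V) : G.mult u v = G.mult v u := by
  rw [mult, mult, Sym2.eq_swap]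

theorem mult_self (G : Multigraph V) (v : V) : G.mult v v = 0 :=
  Multiset.count_eq_zero.2 fun h => G.loopless _ h (Sym2.mk_isDiag_iff.2 rfl)

theorem mult_pos_iff (G : Multigraph V) {u v : V} :
    0 < G.mult u v ↔ G.toSimpleGraph.Adj u v := Multiset.count_pos

theorem card_edgesBetween_singleton (G : Multigraph V) (v w : V) :
    Multiset.card (G.edgesBetween {v} {w}) = G.mult v w := by
  simp only [edgesBetween, mult, Multiset.count, Finset.mem_singleton, exists_eq_left,
    Multiset.countP_eq_card_filter]
  congr 1
  exact Multiset.filter_congr fun e _ => eq_comm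

/-- Equality can fail because `A` and `B` may overlap: an edge inside `A ∩ B` is counted twice on
the right. -/
theorem card_edgesBetween_le (G : Multigraph V) (A B : Finset V) :
    Multiset.card (G.edgesBetween A B) ≤ ∑ a ∈ A, ∑ b ∈ B, G.mult a b := by
  simp only [edgesBetween, mult, ← Multiset.countP_eq_card_filter]
  induction G.edges using Multiset.induction with
  | empty => simp
  | cons e s ih =>
    simp only [Multiset.countP_cons, Multiset.count_cons, Finset.sum_add_distrib]
    refine add_le_add ih ?_
    split_ifs with h
    · obtain ⟨a, ha, b, hb, rfl⟩ := h
      calc 1 = if s(a, b) = s(a, b) then 1 else 0 := by simp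
        _ ≤ ∑ b' ∈ B, if s(a, b') = s(a, b) then 1 else 0 :=
          Finset.single_le_sum (f := fun b' => if s(a, b') = s(a, b) then 1 else 0)
            (fun _ _ => Nat.zero_le _) hb
        _ ≤ _ := Finset.single_le_sum
            (f := fun a' => ∑ b' ∈ B, if s(a', b') = s(a, b) then 1 else 0)
            (fun _ _ => Nat.zero_le _) ha
    · exact Nat.zero_le _

theorem DivEquiv.trans {G : Multigraph V} {D₁ D₂ D₃ : V → ℤ} (h : G.DivEquiv D₁ D₂)
    (h' : G.DivEquiv D₂ D₃) : G.DivEquiv D₁ D₃ := Relation.ReflTransGen.trans h h'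

variable [Fintype V]

theorem val_eq_sum_mult (G : Multigraph V) (w : V) : G.val w = ∑ u, G.mult w u := by
  simp only [val, mult, ← Multiset.countP_eq_card_filter]
  induction G.edges using Multiset.induction with
  | empty => simp
  | cons e s ih =>
    simp only [Multiset.countP_cons, Multiset.count_cons, Finset.sum_add_distrib, ih]
    congr 1
    split_ifs with h
    · obtain ⟨x, rfl⟩ := h
      simp only [Sym2.congr_right, Finset.sum_ite_eq', Finset.mem_univ, if_true]
    · symm
      refine Finset.sum_eq_zero fun u _ => if_neg ?_
      rintro rfl
      exact h (Sym2.mem_mk_left _ _)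

/-- The Laplacian of a function on the vertices. -/
def lap (G : Multigraph V) (f : V → ℤ) (v : V) : ℤ := ∑ u, (G.mult v u : ℤ) * (f v - f u)

theorem lap_zero (G : Multigraph V) : G.lap 0 = 0 := by
  ext v; simp [lap]

theorem lap_add (G : Multigraph V) (f g : V → ℤ) : G.lap (f + g) = G.lap f + G.lap g := by
  ext v
  simp only [lap, Pi.add_apply, ← Finset.sum_add_distrib]
  exact Finset.sum_congr rfl fun u _ => by ring

theorem lap_neg (G : Multigraph V) (f : V → ℤ) : G.lap (-f) = -G.lap f := by
  ext v
  simp only [lap, Pi.neg_apply, ← Finset.sum_neg_distrib]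
  exact Finset.sum_congr rfl fun u _ => by ring

theorem lap_add_const (G : Multigraph V) (f : V → ℤ) (c : ℤ) :
    G.lap (fun v => f v + c) = G.lap f := by
  ext v
  exact Finset.sum_congr rfl fun u _ => by ring

theorem sum_lap (G : Multigraph V) (f : V → ℤ) : ∑ v, G.lap f v = 0 := by
  have h : ∑ v, G.lap f v = -∑ v, G.lap f v := by
    conv_lhs => simp only [lap]
    rw [Finset.sum_comm]
    simp only [lap, ← Finset.sum_neg_distrib]
    refine Finset.sum_congr rfl fun u _ => Finset.sum_congr rfl fun v _ => ?_
    rw [G.mult_comm v u]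
    ring
  linarith

theorem fire_eq (G : Multigraph V) (w : V) (D : V → ℤ) :
    G.fire w D = D - G.lap (Pi.single w 1) := by
  ext v
  simp only [fire, Pi.sub_apply, lap]
  split_ifs with h
  · subst h
    rw [val_eq_sum_mult, Nat.cast_sum]
    congr 1
    refine Finset.sum_congr rfl fun u _ => ?_
    rcases eq_or_ne u v with rfl | hu
    · simp [mult_self]
    · simp [hu]
  · rw [card_edgesBetween_singleton, Finset.sum_eq_single w]
    · simp [h]
    · intro u _ hu
      simp [hu, h]
    · simp

theorem divEquiv_sub_lap_natCast (G : Multigraph V) (f : V → ℕ) (D : V → ℤ) :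
    G.DivEquiv D (D - G.lap fun v => (f v : ℤ)) := by
  induction hn : ∑ v, f v generalizing f with
  | zero =>
    have : (fun v => (f v : ℤ)) = 0 := by
      ext v
      simpa using Finset.sum_eq_zero_iff.1 hn v (Finset.mem_univ v)
    rw [this, lap_zero, sub_zero]
    exact Relation.ReflTransGen.refl
  | succ n ih =>
    obtain ⟨w, -, hw⟩ : ∃ w ∈ Finset.univ, f w ≠ 0 := by
      by_contra! h
      simp [Finset.sum_eq_zero h] at hn
    obtain ⟨g, hg⟩ : ∃ g : V → ℕ, f = g + Pi.single w 1 := by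
      refine ⟨f - Pi.single w 1, ?_⟩
      ext v
      rcases eq_or_ne v w with rfl | hv
      · simp; omega
      · simp [hv]
    have hgn : ∑ v, g v = n := by
      rw [hg] at hn
      simp only [Pi.add_apply, Finset.sum_add_distrib, Finset.sum_pi_single', Finset.mem_univ,
        if_true] at hn
      simpa using hn
    refine (ih g hgn).tail ⟨w, ?_⟩
    have : (fun v => (f v : ℤ)) = (fun v => (g v : ℤ)) + Pi.single w 1 := by
      ext v
      rcases eq_or_ne v w with rfl | hv
      · simp [hg]
      · simp [hg, hv]
    rw [fire_eq, this, lap_add, sub_sub]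

/-- Moves only fire and never borrow, but constants lie in the kernel of the Laplacian, so any
integer script can be shifted to a nonnegative one. -/
theorem divEquiv_iff (G : Multigraph V) (D D' : V → ℤ) :
    G.DivEquiv D D' ↔ ∃ f : V → ℤ, D' = D - G.lap f := by
  constructor
  · intro h
    induction h with
    | refl => exact ⟨0, by simp [lap_zero]⟩
    | tail _ h ih =>
      obtain ⟨f, rfl⟩ := ih
      obtain ⟨w, rfl⟩ := h
      exact ⟨f + Pi.single w 1, by rw [fire_eq, lap_add, sub_sub]⟩
  · rintro ⟨f, rfl⟩
    obtain ⟨c, hc⟩ : ∃ c : ℤ, ∀ v, 0 ≤ f v + c :=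
      ⟨∑ v, |f v|, fun v => by
        have h1 := Finset.single_le_sum (f := fun v => |f v|) (fun v _ => abs_nonneg _)
          (Finset.mem_univ v)
        have h2 := neg_abs_le (f v)
        linarith⟩
    have h := G.divEquiv_sub_lap_natCast (fun v => (f v + c).toNat) D
    have e : (fun v => ((f v + c).toNat : ℤ)) = fun v => f v + c :=
      funext fun v => Int.toNat_of_nonneg (hc v)
    rwa [e, lap_add_const] at h

theorem DivEquiv.symm {G : Multigraph V} {D D' : V → ℤ} (h : G.DivEquiv D D') :
    G.DivEquiv D' D := by
  obtain ⟨f, rfl⟩ := (divEquiv_iff _ _ _).1 h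
  exact (divEquiv_iff _ _ _).2 ⟨-f, by rw [lap_neg]; abel⟩

theorem DivEquiv.add_right {G : Multigraph V} {D D' : V → ℤ} (h : G.DivEquiv D D')
    (E : V → ℤ) : G.DivEquiv (D + E) (D' + E) := by
  obtain ⟨f, rfl⟩ := (divEquiv_iff _ _ _).1 h
  exact (divEquiv_iff _ _ _).2 ⟨f, by abel⟩

theorem DivEquiv.degree_eq {G : Multigraph V} {D D' : V → ℤ} (h : G.DivEquiv D D') :
    degree D' = degree D := by
  obtain ⟨f, rfl⟩ := (divEquiv_iff _ _ _).1 h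
  simp [degree, sum_lap]

theorem EquivEffective.degree_nonneg {G : Multigraph V} {D : V → ℤ} (h : G.EquivEffective D) :
    0 ≤ degree D := by
  obtain ⟨D', h, h0⟩ := h
  rw [← h.degree_eq]
  exact Finset.sum_nonneg fun v _ => h0 v

theorem degree_single (v : V) (r : ℤ) : degree (Pi.single v r) = r := by
  simp [degree]

/-- A divisor has positive rank if and only if every vertex carries a chip in some equivalent
effective divisor. -/
theorem rank_pos_iff [Nonempty V] (G : Multigraph V) (D : V → ℤ) :
    0 < G.rank D ↔ ∀ v, ∃ D', G.DivEquiv D D' ∧ (∀ u, 0 ≤ D' u) ∧ 1 ≤ D' v := by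
  classical
  constructor
  · intro h v
    rw [rank] at h
    by_cases hD : G.EquivEffective D
    · rw [if_pos hD] at h
      set R := {r : ℕ | ∀ E : V → ℤ, (∀ v, 0 ≤ E v) → degree E = r →
        G.EquivEffective (D - E)} with hR
      have hpos : 0 < sSup R := by exact_mod_cast h
      -- The natural `sSup` is 0 on unbounded and on empty sets, so its positivity excludes both and
      -- the supremum is attained.
      have hb : BddAbove R := by
        by_contra hb
        rw [csSup_of_not_bddAbove hb] at hpos
        simp at hpos
      have hne : R.Nonempty := by
        by_contra hne
        rw [Set.not_nonempty_iff_eq_empty.1 hne] at hpos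
        simp at hpos
      obtain ⟨D', hD', h0⟩ := Nat.sSup_mem hne hb (Pi.single v (sSup R : ℕ))
        (fun u => by
          rcases eq_or_ne u v with rfl | hu
          · simp
          · simp [hu])
        (degree_single _ _)
      refine ⟨D' + Pi.single v ((sSup R : ℕ) : ℤ), ?_, fun u => ?_, ?_⟩
      · simpa using hD'.add_right (Pi.single v ((sSup R : ℕ) : ℤ))
      · refine add_nonneg (h0 u) ?_
        rcases eq_or_ne u v with rfl | hu
        · simp
        · simp [hu]
      · have := h0 v
        have h1 : (1 : ℤ) ≤ (sSup R : ℕ) := by exact_mod_cast hpos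
        simp only [Pi.add_apply, Pi.single_eq_same]
        linarith
    · rw [if_neg hD] at h
      omega
  · intro h
    obtain ⟨v₀⟩ := ‹Nonempty V›
    have hD : G.EquivEffective D := by
      obtain ⟨D', h1, h2, -⟩ := h v₀
      exact ⟨D', h1, h2⟩
    rw [rank, if_pos hD]
    refine Int.natCast_pos.2 (Nat.lt_of_lt_of_le Nat.zero_lt_one (le_csSup ?_ ?_))
    -- Placing all `r` chips of `E` on `v₀` shows that `r` cannot exceed the degree.
    · refine ⟨(degree D).toNat, fun r hr => ?_⟩
      have := (hr (Pi.single v₀ (r : ℤ)) (fun u => by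
          rcases eq_or_ne u v₀ with rfl | hu
          · simp
          · simp [hu]) (degree_single _ _)).degree_nonneg
      rw [degree_sub, degree_single] at this
      omega
    · intro E hE hdeg
      obtain ⟨v, hv⟩ : ∃ v, E v ≠ 0 := by
        by_contra! h0
        simp [degree, h0] at hdeg
      have hEv : E = Pi.single v 1 := by
        have hs : E v + ∑ u ∈ Finset.univ.erase v, E u = 1 := by
          rw [Finset.add_sum_erase _ _ (Finset.mem_univ v)]
          simpa [degree] using hdeg
        have hp := hE v
        have hq : 0 ≤ ∑ u ∈ Finset.univ.erase v, E u := Finset.sum_nonneg fun u _ => hE u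
        have hq0 : ∑ u ∈ Finset.univ.erase v, E u = 0 := by omega
        ext u
        rcases eq_or_ne u v with rfl | hu
        · simp; omega
        · rw [Pi.single_eq_of_ne hu]
          exact (Finset.sum_eq_zero_iff_of_nonneg fun u _ => hE u).1 hq0 u (by simp [hu])
      subst hEv
      obtain ⟨D', h1, h2, h3⟩ := h v
      refine ⟨D' - Pi.single v 1, ?_, fun u => ?_⟩
      · simpa [sub_eq_add_neg] using h1.add_right (-Pi.single v 1)
      · rcases eq_or_ne u v with rfl | hu
        · simpa using h3
        · simpa [hu] using h2 u

end Laplacian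

/-! ### Level sets of firing scripts and the bound sn ≤ gon. -/

section Gonality

variable {V : Type*} [DecidableEq V] [Fintype V]

theorem gonality_le {G : Multigraph V} {D : V → ℤ} {d : ℕ} (h : 0 < G.rank D)
    (hd : degree D = d) : G.gonality ≤ d := Nat.sInf_le ⟨D, h, hd⟩

/-- The minimum in the definition of the gonality exists. -/
theorem exists_degree_eq_gonality [Nonempty V] (G : Multigraph V) :
    ∃ D : V → ℤ, 0 < G.rank D ∧ degree D = G.gonality := by
  refine Nat.sInf_mem (s := {d : ℕ | ∃ D : V → ℤ, 0 < G.rank D ∧ degree D = d})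
    ⟨Fintype.card V, 1, ?_, by simp [degree]⟩
  rw [rank_pos_iff]
  exact fun v => ⟨1, Relation.ReflTransGen.refl, fun _ => zero_le_one, le_rfl⟩

/-- The stages of the level set decomposition of a firing script between effective divisors are
effective. -/
theorem sub_lap_max_nonneg (G : Multigraph V) {D f : V → ℤ} (hD : ∀ v, 0 ≤ D v)
    (hD' : ∀ v, 0 ≤ (D - G.lap f) v) (c : ℤ) (v : V) :
    0 ≤ (D - G.lap fun u => max (f u - c) 0) v := by
  -- Below level `c` the truncated script is minimal at `v`, so `v` loses nothing from `D`. Above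
  -- it, truncation only lowers the Laplacian at `v`, so `v` keeps at least its final amount.
  rcases le_total (f v) c with h | h
  · have : G.lap (fun u => max (f u - c) 0) v ≤ 0 :=
      Finset.sum_nonpos fun u _ => mul_nonpos_of_nonneg_of_nonpos (by positivity) (by dsimp only; omega)
    have := hD v
    simp only [Pi.sub_apply]
    linarith
  · refine (hD' v).trans (sub_le_sub_left (Finset.sum_le_sum fun u _ => ?_) _)
    exact mul_le_mul_of_nonneg_left (by dsimp only; omega) (by positivity)

/-- The Laplacian of the indicator of `U`. -/
theorem lap_indicator_of_mem (G : Multigraph V) {U : Finset V} {v : V} (hv : v ∈ U) :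
    G.lap (fun u => if u ∈ U then 1 else 0) v = ∑ u ∈ Uᶜ, (G.mult v u : ℤ) := by
  simp only [lap, if_pos hv]
  rw [← Finset.sum_subset (Finset.subset_univ Uᶜ)]
  · exact Finset.sum_congr rfl fun u hu => by simp [Finset.mem_compl.1 hu]
  · intro u _ hu
    simp only [Finset.mem_compl, not_not] at hu
    simp [hu]

theorem lap_indicator_of_notMem (G : Multigraph V) {U : Finset V} {v : V} (hv : v ∉ U) :
    G.lap (fun u => if u ∈ U then 1 else 0) v = -∑ u ∈ U, (G.mult v u : ℤ) := by
  simp only [lap, if_neg hv]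
  rw [← Finset.sum_subset (Finset.subset_univ U), ← Finset.sum_neg_distrib]
  · exact Finset.sum_congr rfl fun u hu => by simp [hu]
  · intro u _ hu
    simp [hu]

/-- A vertex of `U` pays one chip for each edge leaving `U` and ends without debt, so it held that
many chips before. -/
theorem card_edgesBetween_le_degree (G : Multigraph V) {D : V → ℤ} {U : Finset V}
    (hD : ∀ v, 0 ≤ D v)
    (hD' : ∀ v, 0 ≤ (D - G.lap fun u => if u ∈ U then 1 else 0) v) :
    (Multiset.card (G.edgesBetween U Uᶜ) : ℤ) ≤ degree D :=
  calc (Multiset.card (G.edgesBetween U Uᶜ) : ℤ)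
      ≤ ∑ a ∈ U, ∑ b ∈ Uᶜ, (G.mult a b : ℤ) := by exact_mod_cast G.card_edgesBetween_le U Uᶜ
    _ ≤ ∑ a ∈ U, D a := Finset.sum_le_sum fun a ha => by
        have := hD' a
        rw [Pi.sub_apply, lap_indicator_of_mem G ha] at this
        linarith
    _ ≤ degree D := Finset.sum_le_sum_of_subset_of_nonneg (Finset.subset_univ _)
        fun v _ _ => hD v

/-- If firing `U` moves chips onto a connected set without chips, that set is disjoint
from `U`. -/
theorem ConnectedSubset.subset_compl_of_fire {G : Multigraph V} {E U : Finset V} {D : V → ℤ}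
    (hE : G.ConnectedSubset E) (hD' : ∀ v, 0 ≤ (D - G.lap fun u => if u ∈ U then 1 else 0) v)
    (h0 : ∀ v ∈ E, D v = 0) {b : V} (hb : b ∈ E)
    (hb1 : 0 < (D - G.lap fun u => if u ∈ U then 1 else 0) b) : E ⊆ Uᶜ := by
  have hbU : b ∉ U := fun hbU => by
    rw [Pi.sub_apply, lap_indicator_of_mem G hbU, h0 b hb] at hb1
    have : (0 : ℤ) ≤ ∑ u ∈ Uᶜ, (G.mult b u : ℤ) := by positivity
    linarith
  intro a ha
  rw [Finset.mem_compl]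
  intro haU
  -- An edge of `E` leaving `U` would put its chipless end `x` into debt.
  obtain ⟨x, hx, hxU, y, -, hyU, hxy⟩ := hE.exists_adj ha haU hb hbU
  have h1 := hD' x
  rw [Pi.sub_apply, lap_indicator_of_mem G hxU, h0 x hx] at h1
  have h2 : (G.mult x y : ℤ) ≤ ∑ u ∈ Uᶜ, (G.mult x u : ℤ) :=
    Finset.single_le_sum (f := fun u => (G.mult x u : ℤ)) (fun u _ => by positivity)
      (Finset.mem_compl.2 hyU)
  have h3 := G.mult_pos_iff.2 hxy
  omega

/-- If firing `U` removes all chips from a connected set, that set is contained in `U`. -/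
theorem ConnectedSubset.subset_of_fire {G : Multigraph V} {E U : Finset V} {D : V → ℤ}
    (hE : G.ConnectedSubset E) (hD : ∀ v, 0 ≤ D v)
    (h0 : ∀ v ∈ E, (D - G.lap fun u => if u ∈ U then 1 else 0) v = 0) {a : V} (ha : a ∈ E)
    (ha1 : 0 < D a) : E ⊆ U := by
  have haU : a ∈ U := by
    by_contra haU
    have h1 := h0 a ha
    rw [Pi.sub_apply, lap_indicator_of_notMem G haU] at h1
    have : (0 : ℤ) ≤ ∑ u ∈ U, (G.mult a u : ℤ) := by positivity
    linarith
  intro b hb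
  by_contra hbU
  obtain ⟨x, -, hxU, y, hy, hyU, hxy⟩ := hE.exists_adj ha haU hb hbU
  have h1 := h0 y hy
  rw [Pi.sub_apply, lap_indicator_of_notMem G hyU] at h1
  have h2 : (G.mult y x : ℤ) ≤ ∑ u ∈ U, (G.mult y u : ℤ) :=
    Finset.single_le_sum (f := fun u => (G.mult y u : ℤ)) (fun u _ => by positivity) hxU
  have h3 := G.mult_pos_iff.2 hxy.symm
  have := hD y
  omega

open Classical in
/-- The order of a scramble is at most the degree of every divisor of positive rank. -/
theorem Scramble.OrderAtLeast.le_degree [Nonempty V] {G : Multigraph V} {S : G.Scramble} {k : ℕ}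
    (hS : S.OrderAtLeast k) {D : V → ℤ} (hD : 0 < G.rank D) : (k : ℤ) ≤ degree D := by
  rw [rank_pos_iff] at hD
  let hit (D' : V → ℤ) : Finset (Finset V) := S.eggs.filter fun E => ∃ v ∈ E, 0 < D' v
  -- Extremal choice: the support of `D₀` meets as many eggs as possible.
  obtain ⟨D₀, ⟨hD₀, hpos₀⟩, hmax⟩ : ∃ D₀, (G.DivEquiv D D₀ ∧ ∀ v, 0 ≤ D₀ v) ∧
      ∀ D', G.DivEquiv D D' → (∀ v, 0 ≤ D' v) → (hit D').card ≤ (hit D₀).card := by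
    obtain ⟨D₁, h1, h2, -⟩ := hD (Classical.arbitrary V)
    have hfin : ({n : ℕ | ∃ D', (G.DivEquiv D D' ∧ ∀ v, 0 ≤ D' v) ∧
        (hit D').card = n}).Finite :=
      (Set.finite_Iic S.eggs.card).subset (by
        rintro _ ⟨D', -, rfl⟩
        exact Finset.card_le_card (Finset.filter_subset _ _))
    obtain ⟨n, ⟨D₀, h0, rfl⟩, hn⟩ := Set.exists_max_image _ id hfin ⟨_, D₁, ⟨h1, h2⟩, rfl⟩
    exact ⟨D₀, h0, fun D' h h' => hn _ ⟨D', ⟨h, h'⟩, rfl⟩⟩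
  by_contra! hk
  rw [← hD₀.degree_eq] at hk
  obtain ⟨E, hE, hE0⟩ : ∃ E ∈ S.eggs, ∀ v ∈ E, D₀ v = 0 := by
    have hcard : (Finset.univ.filter fun v => 0 < D₀ v).card < k := by
      have : ((Finset.univ.filter fun v => 0 < D₀ v).card : ℤ) ≤ degree D₀ := by
        rw [Finset.card_eq_sum_ones, Nat.cast_sum, degree, Finset.sum_filter]
        refine Finset.sum_le_sum fun v _ => ?_
        have := hpos₀ v
        split_ifs <;> simp <;> omega
      omega
    have := hS.1 _ hcard
    push Not at this
    obtain ⟨E, hE, hne⟩ := this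
    refine ⟨E, hE, fun v hv => ?_⟩
    by_contra hv0
    have : v ∈ (Finset.univ.filter fun v => 0 < D₀ v) ∩ E := by
      have := hpos₀ v
      simp only [Finset.mem_inter, Finset.mem_filter, Finset.mem_univ, true_and]
      exact ⟨by omega, hv⟩
    rw [hne] at this
    simp at this
  obtain ⟨⟨v, hv⟩⟩ := (S.connected E hE).nonempty
  obtain ⟨D', hDD', hpos', hv1⟩ := hD v
  obtain ⟨f, rfl⟩ := (divEquiv_iff _ _ _).1 (hD₀.symm.trans hDD')
  obtain ⟨M, hM⟩ : ∃ M : ℤ, ∀ u, f u ≤ M :=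
    ⟨Finset.univ.sup' Finset.univ_nonempty f, fun u => Finset.le_sup' f (Finset.mem_univ u)⟩
  obtain ⟨N, hN⟩ : ∃ N : ℕ, ∀ u, M - N ≤ f u := by
    refine ⟨(M - Finset.univ.inf' Finset.univ_nonempty f).toNat, fun u => ?_⟩
    have := Finset.inf'_le f (Finset.mem_univ u)
    omega
  -- `stage i` is `D₀` after firing the increasing superlevel sets `U 0`, …, `U (i - 1)` of `f`;
  -- after `N` of them the truncation equals `f` up to a constant.
  let stage (i : ℕ) : V → ℤ := D₀ - G.lap fun u => max (f u - (M - i)) 0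
  let U (i : ℕ) : Finset V := Finset.univ.filter fun u => M - i ≤ f u
  have hstage0 : stage 0 = D₀ := by
    have : (fun u => max (f u - (M - (0 : ℕ))) 0) = 0 := by
      ext u
      have := hM u
      simp only [Pi.zero_apply]
      omega
    simp only [stage, this, lap_zero, sub_zero]
  have hstageN : stage N = D₀ - G.lap f := by
    have : (fun u => max (f u - (M - N)) 0) = fun u => f u + (N - M) := by
      ext u
      have := hN u
      omega
    simp only [stage, this, lap_add_const]
  have hstage (i : ℕ) : stage (i + 1) =
      stage i - G.lap fun u => if u ∈ U i then 1 else 0 := by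
    have : (fun u => max (f u - (M - (i + 1 : ℕ))) 0) =
        (fun u => max (f u - (M - i)) 0) + fun u => if u ∈ U i then 1 else 0 := by
      ext u
      simp only [U, Pi.add_apply, Finset.mem_filter, Finset.mem_univ, true_and]
      split_ifs <;> omega
    simp only [stage, this, lap_add, sub_sub]
  have hnn (i : ℕ) : ∀ v, 0 ≤ stage i v := G.sub_lap_max_nonneg hpos₀ hpos' _
  have hequiv (i : ℕ) : G.DivEquiv D (stage i) :=
    hD₀.trans ((divEquiv_iff _ _ _).2 ⟨_, rfl⟩)
  have hEN : ∃ i, ∃ v ∈ E, 0 < stage i v := ⟨N, v, hv, by rw [hstageN]; omega⟩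
  obtain ⟨i, hi⟩ : ∃ i, Nat.find hEN = i + 1 := by
    refine Nat.exists_eq_succ_of_ne_zero fun h0 => ?_
    obtain ⟨u, hu, hu0⟩ := Nat.find_spec hEN
    rw [h0, hstage0, hE0 u hu] at hu0
    exact lt_irrefl _ hu0
  obtain ⟨b, hb, hb1⟩ := Nat.find_spec hEN
  have hEi : ∀ u ∈ E, stage i u = 0 := fun u hu => by
    have := Nat.find_min hEN (m := i) (by omega)
    push Not at this
    exact le_antisymm (this u hu) (hnn i u)
  rw [hi] at hb1
  have hEU : E ⊆ (U i)ᶜ :=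
    (S.connected E hE).subset_compl_of_fire (by rw [← hstage]; exact hnn _) hEi hb
      (by rwa [← hstage])
  -- At stage `i + 1` the egg `E` is newly hit, so by maximality some egg hit by `D₀` is no longer
  -- hit.
  obtain ⟨E', hE', hE'0, hE'1⟩ : ∃ E' ∈ S.eggs, (∃ a ∈ E', 0 < stage 0 a) ∧
      ¬ ∃ a ∈ E', 0 < stage (i + 1) a := by
    by_contra! hcon
    have hlt : (hit D₀) ⊂ hit (stage (i + 1)) := by
      refine (Finset.ssubset_iff_of_subset fun E' h' => ?_).2 ⟨E, ?_, ?_⟩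
      · obtain ⟨h1, h2⟩ := Finset.mem_filter.1 h'
        exact Finset.mem_filter.2 ⟨h1, hcon E' h1 (by rwa [hstage0])⟩
      · exact Finset.mem_filter.2 ⟨hE, b, hb, hb1⟩
      · intro h'
        obtain ⟨-, u, hu, hu0⟩ := Finset.mem_filter.1 h'
        rw [hE0 u hu] at hu0
        exact lt_irrefl _ hu0
    exact absurd (hmax _ (hequiv (i + 1)) (hnn _)) (not_le.2 (Finset.card_lt_card hlt))
  obtain ⟨j, hji, ⟨a, ha, ha1⟩, hj0⟩ : ∃ j ≤ i, (∃ a ∈ E', 0 < stage j a) ∧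
      ¬ ∃ a ∈ E', 0 < stage (j + 1) a := by
    by_contra! hcon
    have : ∀ j ≤ i + 1, ∃ a ∈ E', 0 < stage j a := by
      intro j
      induction j with
      | zero => exact fun _ => hE'0
      | succ j ih => exact fun hj => hcon j (by omega) (ih (by omega))
    exact hE'1 (this _ le_rfl)
  have hE'U : E' ⊆ U j := by
    refine (S.connected E' hE').subset_of_fire (hnn j) (fun u hu => ?_) ha ha1
    rw [← hstage]
    push Not at hj0
    exact le_antisymm (hj0 u hu) (hnn _ u)
  have hUU : U j ⊆ U i := fun u hu => by
    simp only [U, Finset.mem_filter, Finset.mem_univ, true_and] at hu ⊢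
    omega
  -- `E'` loses its last chips when `U j` is fired, so it lies in `U j`, while `E` avoids the larger
  -- `U i`. Hence `U j` separates two eggs, and firing it costs at least `k` chips.
  have hcut := hS.2 (U j) ⟨E', hE', hE'U⟩
    ⟨E, hE, hEU.trans (Finset.compl_subset_compl.2 hUU)⟩
  have hle := G.card_edgesBetween_le_degree (hnn j) (U := U j)
    (by rw [← hstage]; exact hnn _)
  rw [(hequiv j).degree_eq, ← hD₀.degree_eq] at hle
  omega

/-- The scramble number is a lower bound on the gonality. -/
theorem scrambleNumber_le_gonality [Nonempty V] (G : Multigraph V) :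
    G.scrambleNumber ≤ G.gonality := by
  obtain ⟨D, hD, hdeg⟩ := G.exists_degree_eq_gonality
  obtain ⟨S, hS⟩ := G.isGreatest_scrambleNumber.1
  have := S.isGreatest_order.1.le_degree hD
  rw [hdeg] at this
  simp only at hS
  rw [← hS]
  exact_mod_cast this

theorem Scramble.OrderAtLeast.le_scrambleNumber {G : Multigraph V} {S : G.Scramble} {k : ℕ}
    (h : S.OrderAtLeast k) : k ≤ G.scrambleNumber :=
  (S.isGreatest_order.2 h).trans (G.isGreatest_scrambleNumber.2 ⟨S, rfl⟩)

end Gonality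


/-! ### Divisors, edge cuts and scrambles on products. -/

section Product

variable {V W : Type*} [Fintype V] [DecidableEq V] [Fintype W] [DecidableEq W]

theorem count_map_copy {α β : Type*} [DecidableEq α] [DecidableEq β] (s : Multiset (Sym2 α))
    {i : α → β} (hi : Function.Injective i) (a b : α) :
    (s.map (Sym2.map i)).count s(i a, i b) = s.count s(a, b) :=
  Multiset.count_map_eq_count' (Sym2.map i) s (Sym2.map.injective hi) s(a, b)

theorem mult_boxProd (G : Multigraph V) (H : Multigraph W) (x y : V × W) :
    (G.boxProd H).mult x y =
      (if x.2 = y.2 then G.mult x.1 y.1 else 0) + (if x.1 = y.1 then H.mult x.2 y.2 else 0) := by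
  obtain ⟨a, c⟩ := x
  obtain ⟨b, d⟩ := y
  simp only [mult, boxProd, Multiset.count_add, Multiset.count_sum']
  congr 1
  · rw [Finset.sum_eq_single c]
    · split_ifs with h
      · subst h
        exact count_map_copy G.edges (i := fun u => (u, c))
          (fun _ _ h => (Prod.ext_iff.1 h).1) a b
      · refine Multiset.count_eq_zero.2 fun hm => h ?_
        obtain ⟨e, -, he⟩ := Multiset.mem_map.1 hm
        have hd : (b, d) ∈ Sym2.map (fun u => (u, c)) e := he ▸ Sym2.mem_mk_right _ _
        obtain ⟨u, -, hu⟩ := Sym2.mem_map.1 hd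
        exact (Prod.ext_iff.1 hu).2
    · intro w _ hw
      refine Multiset.count_eq_zero.2 fun hm => hw ?_
      obtain ⟨e, -, he⟩ := Multiset.mem_map.1 hm
      have hd : (a, c) ∈ Sym2.map (fun u => (u, w)) e := he ▸ Sym2.mem_mk_left _ _
      obtain ⟨u, -, hu⟩ := Sym2.mem_map.1 hd
      exact (Prod.ext_iff.1 hu).2
    · simp
  · rw [Finset.sum_eq_single a]
    · split_ifs with h
      · subst h
        exact count_map_copy H.edges (i := fun w => (a, w))
          (fun _ _ h => (Prod.ext_iff.1 h).2) c d
      · refine Multiset.count_eq_zero.2 fun hm => h ?_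
        obtain ⟨e, -, he⟩ := Multiset.mem_map.1 hm
        have hd : (b, d) ∈ Sym2.map (fun w => (a, w)) e := he ▸ Sym2.mem_mk_right _ _
        obtain ⟨u, -, hu⟩ := Sym2.mem_map.1 hd
        exact (Prod.ext_iff.1 hu).1
    · intro v _ hv
      refine Multiset.count_eq_zero.2 fun hm => hv ?_
      obtain ⟨e, -, he⟩ := Multiset.mem_map.1 hm
      have hd : (a, c) ∈ Sym2.map (fun w => (v, w)) e := he ▸ Sym2.mem_mk_left _ _
      obtain ⟨u, -, hu⟩ := Sym2.mem_map.1 hd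
      exact (Prod.ext_iff.1 hu).1
    · simp

theorem lap_boxProd (G : Multigraph V) (H : Multigraph W) (F : V × W → ℤ) (x : V × W) :
    (G.boxProd H).lap F x =
      G.lap (fun u => F (u, x.2)) x.1 + H.lap (fun w => F (x.1, w)) x.2 := by
  obtain ⟨a, c⟩ := x
  simp only [lap, mult_boxProd, Nat.cast_add, add_mul, Finset.sum_add_distrib,
    Fintype.sum_prod_type]
  congr 1
  · refine Finset.sum_congr rfl fun u _ => ?_
    rw [Finset.sum_eq_single c] <;> simp +contextual [eq_comm]
  · rw [Finset.sum_eq_single a] <;> simp +contextual [eq_comm]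

/-- A function constant along the copies of `H` has no Laplacian contribution from their edges. -/
theorem lap_boxProd_comp_fst (G : Multigraph V) (H : Multigraph W) (f : V → ℤ) :
    (G.boxProd H).lap (f ∘ Prod.fst) = G.lap f ∘ Prod.fst := by
  ext x
  rw [lap_boxProd]
  simp [lap]

theorem lap_boxProd_comp_snd (G : Multigraph V) (H : Multigraph W) (f : W → ℤ) :
    (G.boxProd H).lap (f ∘ Prod.snd) = H.lap f ∘ Prod.snd := by
  ext x
  rw [lap_boxProd]
  simp [lap]

theorem gonality_boxProd_le_gonality_mul_card [Nonempty V] [Nonempty W] (G : Multigraph V)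
    (H : Multigraph W) : (G.boxProd H).gonality ≤ G.gonality * Fintype.card W := by
  obtain ⟨D, hD, hdeg⟩ := G.exists_degree_eq_gonality
  refine gonality_le (D := D ∘ Prod.fst) ?_ ?_
  · rw [rank_pos_iff] at hD ⊢
    intro x
    obtain ⟨D', h, h0, h1⟩ := hD x.1
    obtain ⟨f, rfl⟩ := (divEquiv_iff _ _ _).1 h
    refine ⟨_, (divEquiv_iff _ _ _).2 ⟨f ∘ Prod.fst, rfl⟩, ?_⟩
    rw [lap_boxProd_comp_fst]
    exact ⟨fun u => h0 u.1, h1⟩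
  · rw [degree] at hdeg
    simp only [degree, Function.comp, Fintype.sum_prod_type, Finset.sum_const, Finset.card_univ,
      ← Finset.smul_sum, hdeg]
    push_cast
    simp [mul_comm]

theorem gonality_boxProd_le_card_mul_gonality [Nonempty V] [Nonempty W] (G : Multigraph V)
    (H : Multigraph W) : (G.boxProd H).gonality ≤ Fintype.card V * H.gonality := by
  obtain ⟨D, hD, hdeg⟩ := H.exists_degree_eq_gonality
  refine gonality_le (D := D ∘ Prod.snd) ?_ ?_
  · rw [rank_pos_iff] at hD ⊢
    intro x
    obtain ⟨D', h, h0, h1⟩ := hD x.2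
    obtain ⟨f, rfl⟩ := (divEquiv_iff _ _ _).1 h
    refine ⟨_, (divEquiv_iff _ _ _).2 ⟨f ∘ Prod.snd, rfl⟩, ?_⟩
    rw [lap_boxProd_comp_snd]
    exact ⟨fun u => h0 u.2, h1⟩
  · rw [degree] at hdeg
    simp [degree, Fintype.sum_prod_type, hdeg]

/-- On a tree, a chip can be moved along an edge. -/
theorem IsTree.divEquiv_single_of_adj {G : Multigraph V} (hG : G.IsTree) {u v : V}
    (huv : G.toSimpleGraph.Adj u v) :
    G.DivEquiv (Pi.single u 1) (Pi.single v 1) := by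
  classical
  have hbr := SimpleGraph.isAcyclic_iff_forall_adj_isBridge.1 hG.2.isAcyclic huv
  rw [SimpleGraph.isBridge_iff] at hbr
  -- The component of `u` once the bridge `uv` is deleted. That edge, of multiplicity one, is the
  -- only one leaving `U`, so firing `U` moves exactly one chip from `u` to `v`.
  let U : Finset V :=
    Finset.univ.filter fun x => (G.toSimpleGraph.deleteEdges {s(u, v)}).Reachable u x
  have huU : u ∈ U := by simp [U]
  have hvU : v ∉ U := by simpa [U] using hbr
  have hcross : ∀ x ∈ U, ∀ y ∉ U, G.mult x y = if x = u ∧ y = v then 1 else 0 := by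
    intro x hx y hy
    split_ifs with h
    · obtain ⟨rfl, rfl⟩ := h
      exact Multiset.count_eq_one_of_mem hG.1 huv
    · by_contra h0
      have hadj := G.mult_pos_iff.1 (Nat.pos_of_ne_zero h0)
      refine hy ?_
      simp only [U, Finset.mem_filter, Finset.mem_univ, true_and] at hx ⊢
      refine hx.trans (SimpleGraph.Adj.reachable ?_)
      rw [SimpleGraph.deleteEdges_adj]
      refine ⟨hadj, fun he => ?_⟩
      rcases Sym2.eq_iff.1 (Set.mem_singleton_iff.1 he) with h' | ⟨rfl, rfl⟩
      · exact h h'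
      · exact hvU (by simpa [U] using hx)
  refine (divEquiv_iff _ _ _).2 ⟨fun x => if x ∈ U then 1 else 0, ?_⟩
  ext x
  rw [Pi.sub_apply]
  by_cases hx : x ∈ U
  · have hxv : x ≠ v := fun h => hvU (h ▸ hx)
    rw [lap_indicator_of_mem G hx, Finset.sum_congr rfl fun y hy => by
      rw [hcross x hx y (Finset.mem_compl.1 hy)]]
    rcases eq_or_ne x u with rfl | hxu
    · simp [hxv, hvU]
    · simp [hxv, hxu]
  · have hxu : x ≠ u := fun h => hx (h ▸ huU)
    rw [lap_indicator_of_notMem G hx, Finset.sum_congr rfl fun y hy => by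
      rw [G.mult_comm, hcross y hy x hx]]
    rcases eq_or_ne x v with rfl | hxv
    · simp [hxu, huU]
    · simp [hxv, hxu]

theorem IsTree.divEquiv_single {G : Multigraph V} (hG : G.IsTree) (u v : V) :
    G.DivEquiv (Pi.single u 1) (Pi.single v 1) := by
  obtain ⟨p⟩ := hG.2.connected.preconnected u v
  induction p with
  | nil => exact Relation.ReflTransGen.refl
  | cons h _ ih => exact (hG.divEquiv_single_of_adj h).trans ih

theorem IsTree.gonality_le_one {G : Multigraph V} (hG : G.IsTree) : G.gonality ≤ 1 := by
  have : Nonempty V := hG.2.connected.nonempty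
  obtain ⟨u⟩ := this
  refine gonality_le (D := Pi.single u 1) ?_ (by simp [degree_single])
  have : Nonempty V := ⟨u⟩
  rw [rank_pos_iff]
  refine fun v => ⟨_, hG.divEquiv_single u v, fun x => ?_, by simp⟩
  rcases eq_or_ne x v with rfl | h
  · simp
  · simp [h]

theorem edgeConnectivity_le_card {G : Multigraph V} {D : Multiset (Sym2 V)}
    (h : G.IsEdgeCut D) : G.edgeConnectivity ≤ Multiset.card D := Nat.sInf_le ⟨D, h, rfl⟩

/-- The edges leaving a nonempty proper set of vertices form an edge cut. -/
theorem edgeConnectivity_le_card_edgesBetween (G : Multigraph V) {A : Finset V} {a b : V}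
    (ha : a ∈ A) (hb : b ∉ A) :
    G.edgeConnectivity ≤ Multiset.card (G.edgesBetween A Aᶜ) := by
  refine edgeConnectivity_le_card ⟨Multiset.filter_le _ _, Or.inl fun h => ?_⟩
  obtain ⟨p⟩ := SimpleGraph.Connected.preconnected h a b
  obtain ⟨d, -, h1, h2⟩ := p.exists_boundary_dart {x | x ∈ A} ha hb
  have hd : s(d.fst, d.snd) ∈ G.edges - G.edgesBetween A Aᶜ := d.adj
  simp only [edgesBetween, Multiset.sub_filter_eq_filter_not] at hd
  exact (Multiset.mem_filter.1 hd).2 ⟨d.fst, h1, d.snd, Finset.mem_compl.2 h2, rfl⟩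

theorem card_eq_one_of_edgeConnectivity_eq_zero {G : Multigraph V} (hG : G.Connected)
    (h : G.edgeConnectivity = 0) : Fintype.card V = 1 := by
  by_contra hV
  have : Nonempty V := SimpleGraph.Connected.nonempty hG
  have : Nontrivial V := Fintype.one_lt_card_iff_nontrivial.1
    (lt_of_le_of_ne Fintype.card_pos (Ne.symm hV))
  -- The infimum of the empty set is also 0, so a cut must be exhibited: deleting all edges works on
  -- two or more vertices.
  have hne : {n : ℕ | ∃ D, G.IsEdgeCut D ∧ Multiset.card D = n}.Nonempty := by
    refine ⟨_, G.edges, ⟨le_rfl, Or.inl fun hc => ?_⟩, rfl⟩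
    obtain ⟨a, b, hab⟩ := exists_pair_ne V
    obtain ⟨c, hc⟩ := SimpleGraph.Preconnected.exists_adj_of_nontrivial
      (SimpleGraph.Connected.preconnected hc) a
    have : s(a, c) ∈ G.edges - G.edges := hc
    simp at this
  obtain ⟨D, ⟨-, hD⟩, hD0⟩ := Nat.sInf_mem hne
  rw [Multiset.card_eq_zero.1 (hD0.trans h)] at hD
  refine hD.elim (fun hD => hD ?_) hV
  have : G.deleteEdges 0 = G := by
    cases G
    simp [deleteEdges]
  rwa [this]

/-- The copy of the first factor over a vertex of the second factor is connected. -/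
theorem connectedSubset_copy (G : Multigraph V) (H : Multigraph W) (hG : G.Connected) (w : W) :
    (G.boxProd H).ConnectedSubset (Finset.univ ×ˢ {w}) := by
  let i : G.toSimpleGraph →g
      (G.boxProd H).toSimpleGraph.induce ((Finset.univ ×ˢ {w} : Finset (V × W)) : Set (V × W)) :=
    { toFun := fun u => ⟨(u, w), by simp⟩
      map_rel' := fun {a b} h => by
        change (G.boxProd H).toSimpleGraph.Adj (a, w) (b, w)
        rw [← mult_pos_iff, mult_boxProd, if_pos rfl]
        exact Nat.add_pos_left (G.mult_pos_iff.2 h) _ }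
  refine SimpleGraph.Connected.map i ?_ hG
  rintro ⟨⟨u, w'⟩, h⟩
  have : w = w' := by simpa using h
  subst this
  exact ⟨u, rfl⟩

/-- The scramble on a product whose eggs are the copies of the first factor. -/
def copyScramble (G : Multigraph V) (H : Multigraph W) (hG : G.Connected) :
    (G.boxProd H).Scramble where
  eggs := Finset.univ.image fun w => Finset.univ ×ˢ {w}
  connected E hE := by
    obtain ⟨w, -, rfl⟩ := Finset.mem_image.1 hE
    exact connectedSubset_copy G H hG w

/-- The edges leaving a set in a product are at least those leaving its slices. -/
theorem sum_card_edgesBetween_slice_le (G : Multigraph V) (H : Multigraph W)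
    (A : Finset (V × W)) :
    ∑ v : V, Multiset.card (H.edgesBetween (Finset.univ.filter fun w => (v, w) ∈ A)
      (Finset.univ.filter fun w => (v, w) ∈ A)ᶜ) ≤
      Multiset.card ((G.boxProd H).edgesBetween A Aᶜ) := by
  simp only [edgesBetween, boxProd, ← Multiset.countP_eq_card_filter, Multiset.countP_add]
  -- The edges in copies of `G` are discarded.
  refine le_add_left ?_
  rw [← Multiset.coe_countPAddMonoidHom, map_sum]
  refine Finset.sum_le_sum fun v _ => ?_
  rw [Multiset.coe_countPAddMonoidHom, Multiset.countP_map, Multiset.countP_eq_card_filter]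
  refine Multiset.card_le_card (Multiset.monotone_filter_right _ ?_)
  rintro _ ⟨a, ha, b, hb, rfl⟩
  exact ⟨(v, a), by simpa using ha, (v, b), by simpa using hb, rfl⟩

/-- The edge bound is required only when `H` has several vertices: with one vertex there is a single
egg and nothing to separate, although λ(H) = 0. -/
theorem orderAtLeast_copyScramble (G : Multigraph V) (H : Multigraph W) (hG : G.Connected)
    {k : ℕ} (hk : k ≤ Fintype.card W)
    (hk' : Fintype.card W ≠ 1 → k ≤ Fintype.card V * H.edgeConnectivity) :
    (copyScramble G H hG).OrderAtLeast k := by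
  obtain ⟨v₀⟩ : Nonempty V := SimpleGraph.Connected.nonempty hG
  constructor
  · intro C hC hhit
    have : (Finset.univ : Finset W) ⊆ C.image Prod.snd := fun w _ => by
      obtain ⟨x, hx⟩ := hhit (Finset.univ ×ˢ {w})
        (Finset.mem_image_of_mem _ (Finset.mem_univ w))
      rw [Finset.mem_inter, Finset.mem_product, Finset.mem_singleton] at hx
      exact Finset.mem_image.2 ⟨x, hx.1, hx.2.2⟩
    have h1 := (Finset.card_le_card this).trans Finset.card_image_le
    rw [Finset.card_univ] at h1
    omega
  · rintro A ⟨E, hE, hEA⟩ ⟨E', hE', hEA'⟩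
    obtain ⟨w, -, rfl⟩ := Finset.mem_image.1 hE
    obtain ⟨w', -, rfl⟩ := Finset.mem_image.1 hE'
    have hw (v : V) : (v, w) ∈ A := hEA (by simp)
    have hw' (v : V) : (v, w') ∉ A := Finset.mem_compl.1 (hEA' (by simp))
    have hne : w ≠ w' := fun h => hw' v₀ (h ▸ hw v₀)
    have hW : Fintype.card W ≠ 1 := fun h =>
      hne (Fintype.card_le_one_iff.1 h.le w w')
    calc k ≤ Fintype.card V * H.edgeConnectivity := hk' hW
      _ = ∑ _v : V, H.edgeConnectivity := by simp
      _ ≤ _ := Finset.sum_le_sum fun v _ =>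
        H.edgeConnectivity_le_card_edgesBetween (a := w) (b := w')
          (by simpa using hw v) (by simpa using hw' v)
      _ ≤ _ := sum_card_edgesBetween_slice_le G H A

end Product

end Multigraph

theorem mainTheorem7 {V W : Type*} [Fintype V] [DecidableEq V] [Fintype W] [DecidableEq W]
    (G : Multigraph V) (H : Multigraph W) (hG : G.Connected) (hH : H.Connected) :
    (G.IsTree →
      (Fintype.card W : ℚ) / (H.edgeConnectivity : ℚ) ≤ (Fintype.card V : ℚ) →
      (G.boxProd H).scrambleNumber = Fintype.card W ∧
        (G.boxProd H).gonality = Fintype.card W) ∧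
    (H.gonality = H.edgeConnectivity →
      (Fintype.card V : ℚ) ≤ (Fintype.card W : ℚ) / (H.edgeConnectivity : ℚ) →
      (G.boxProd H).scrambleNumber = Fintype.card V * H.edgeConnectivity ∧
        (G.boxProd H).gonality = Fintype.card V * H.edgeConnectivity) := by
  have : Nonempty V := SimpleGraph.Connected.nonempty hG
  have : Nonempty W := SimpleGraph.Connected.nonempty hH
  have hsg := (G.boxProd H).scrambleNumber_le_gonality
  constructor
  · intro hT hle
    have hgon : (G.boxProd H).gonality ≤ Fintype.card W :=
      (G.gonality_boxProd_le_gonality_mul_card H).trans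
        ((Nat.mul_le_mul_right _ hT.gonality_le_one).trans_eq (one_mul _))
    -- The quotient has a nonzero denominator exactly where the edge bound is needed.
    have hsn := (Multigraph.orderAtLeast_copyScramble G H hG le_rfl fun hW => by
      have h0 : (0 : ℚ) < H.edgeConnectivity := Nat.cast_pos.2 (Nat.pos_of_ne_zero fun h =>
        hW (Multigraph.card_eq_one_of_edgeConnectivity_eq_zero hH h))
      rw [div_le_iff₀ h0] at hle
      exact_mod_cast hle).le_scrambleNumber
    omega
  · intro hgonH hle
    have hgon := G.gonality_boxProd_le_card_mul_gonality H
    rw [hgonH] at hgon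
    -- If λ(H) = 0, the quotient is 0 by convention, contradicting that `G` has a vertex.
    have h0 : (0 : ℚ) < H.edgeConnectivity := Nat.cast_pos.2 (Nat.pos_of_ne_zero fun h => by
      rw [h, Nat.cast_zero, div_zero] at hle
      exact absurd (Fintype.card_pos (α := V)) (not_lt.2 (by exact_mod_cast hle)))
    rw [le_div_iff₀ h0] at hle
    have hsn := (Multigraph.orderAtLeast_copyScramble G H hG (by exact_mod_cast hle)
      fun _ => le_rfl).le_scrambleNumber
    omega
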